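/- **Proposition 3.1.** Let $\mathfrak g$ be a finite-dimensional complex simple Lie algebra with Cartan subalgebra $\mathfrak h$, roots $R$, a choice of simple roots $\alpha_j$ and positive roots $R^+$. Let $\mathfrak g_\alpha$ be the root spaces, and let $\varpi_j$, $\varpi_j^\vee$ be the fundamental weights and coweights. Fix a basis of $\mathfrak g$ consisting of the simple coroots $\alpha_j^\vee$ and of root vectors $e_\alpha\in\mathfrak g_\alpha$, $f_\alpha\in\mathfrak g_{-\alpha}$ ($\alpha\in R^+$) with $[e_\alpha,f_\alpha]=\alpha^\vee$ (e.g. a Chevalley basis), and let $e_\alpha^*,f_\alpha^*\in\mathfrak g^*$ be the corresponding coordinate forms. Regard weights $\mu\in\mathfrak h^*$ as linear forms on $\mathfrak g$ vanishing on all root spaces. Fix $i$. Let $R_{P_i}$ be the set of roots that are linear combinations of the $\alpha_j$ with $j\neq i$. Let $\mathfrak l_i=\mathfrak h\oplus\bigoplus_{\alpha\in R_{P_i}}\mathfrak g_\alpha$, and let $\mathrm{pr}_i:\mathfrak g\to\mathfrak l_i$ be the projection along the root spaces $\mathfrak g_\alpha$, $\alpha\notin R_{P_i}$. Let $G$ be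 a connected group with Lie algebra $\mathfrak g$ and $L_i\subset G$ the connected subgroup with Lie algebra $\mathfrak l_i$; both act on $\mathbb C[\mathfrak g]$ through the adjoint action. Let $\langle\mathbb C[\mathfrak g]^G_+\rangle$ be the ideal of $\mathbb C[\mathfrak g]$ generated by the $G$-invariant polynomials without constant term. Let $V$ be the irreducible representation of $\mathfrak g$ with highest weight $\varpi_i$, $v_i\in V$ a highest weight vector, and $v^i\in V^*$ a lowest weight vector (of weight $-\varpi_i$), normalised by $\langle v^i,v_i\rangle=1$. The *order-$n$ Hamiltonian* attached to $\varpi_i$ is $n!$ times the coefficient of $t^{-n}$ in $\langle v^i,\exp(t^{-1}x)v_i\rangle$, that is, the polynomial function $$H_n(x)=\langle v^i,x^nv_i\rangle,\qquad x\in\mathfrak g .$$ Then: 1. $H_1=\varpi_i$. 2. $H_2=\varpi_i^2+\sum_{\alpha\in R^+\setminus R_{P_i}}\langle\varpi_i,\alpha^\vee\rangle\, e_\alpha^*f_\alpha^*$. 3. For every $n$, $H_n$ lies in $\mathbb C[\mathfrak g]^{L_i}$; in particular its class modulo $\langle\mathbb C[\mathfrak g]^G_+\rangle$ lies in the image of $\mathbb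 C[\mathfrak g]^{L_i}$. 4. Suppose that $\varpi_i$ is cominuscule, i.e. $\langle\alpha,\varpi_i^\vee\rangle\in\{-1,0,1\}$ for all $\alpha\in R$. Let $B$ be the multiple of the Killing form of $\mathfrak g$ with $B(\alpha_i^\vee,\alpha_i^\vee)=1$. For an invariant symmetric bilinear form $\beta$ on a Lie algebra $\mathfrak k$ let $\mathrm{Cas}^*_{\mathfrak k,\beta}\in\mathbb C[\mathfrak k]$ be the dual Casimir element $y\mapsto\beta(y,y)$ (equal to $\sum_a u_a^*(u^a)^*$ for $\beta$-dual bases $(u_a)$, $(u^a)$ of $\mathfrak k$), and regard $\mathbb C[\mathfrak l_i]\subset\mathbb C[\mathfrak g]$ via $\mathrm{pr}_i$. Then $$H_2=\varpi_i^2+\mathrm{Cas}^*_{\mathfrak g,B}-\mathrm{Cas}^*_{\mathfrak l_i,B|_{\mathfrak l_i}} .$$ Moreover, $H_2$ is the dual Casimir element of $\mathfrak g$ minus a dual Casimir element of the reductive Lie algebra $\mathfrak l_i$: there is an invariant symmetric bilinear form $\beta$ on $\mathfrak l_i$, satisfying $\beta(x,y)=B(x,y)$ for all $x\in\mathfrak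 l_i$ and $y\in[\mathfrak l_i,\mathfrak l_i]$, and nondegenerate if $\mathfrak g$ has rank at least $2$, such that $$H_2=\mathrm{Cas}^*_{\mathfrak g,B}-\mathrm{Cas}^*_{\mathfrak l_i,\beta}.$$ -/

import Mathlib

open LieAlgebra LieAlgebra.IsKilling Module

noncomputable section

/-! ### Polynomial functions and invariants -/

/-- `ℂ[W]`: the algebra of polynomial functions on a complex vector space `W`, i.e. the algebra of
functions on `W` generated by the linear forms. -/
def polyFun (W : Type*) [AddCommGroup W] [Module ℂ W] : Subalgebra ℂ (W → ℂ) :=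
  Algebra.adjoin ℂ (Set.range fun φ : Dual ℂ W => (φ : W → ℂ))

/-- `ℂ[W]^K`: the polynomial functions that are invariant under a group `K` of linear
automorphisms of `W`. -/
def polyInvariants {W : Type*} [AddCommGroup W] [Module ℂ W] (K : Subgroup (W ≃ₗ[ℂ] W)) :
    Subalgebra ℂ (polyFun W) where
  carrier := {p | ∀ φ ∈ K, ∀ x : W, (p : W → ℂ) (φ x) = (p : W → ℂ) x}
  mul_mem' := fun hp hq φ hφ x => by simp [hp φ hφ x, hq φ hφ x]
  add_mem' := fun hp hq φ hφ x => by simp [hp φ hφ x, hq φ hφ x]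
  algebraMap_mem' := fun _ _ _ _ => rfl

/-- The ideal `⟨ℂ[W]^K_+⟩` of `ℂ[W]` generated by the `K`-invariant polynomial functions without
constant term. -/
def positiveInvariantIdeal {W : Type*} [AddCommGroup W] [Module ℂ W]
    (K : Subgroup (W ≃ₗ[ℂ] W)) : Ideal (polyFun W) :=
  Ideal.span {p | p ∈ polyInvariants K ∧ (p : W → ℂ) 0 = 0}

/-- The exponential of a nilpotent endomorphism, as a finite sum. -/
def nilpotentExp {W : Type*} [AddCommGroup W] [Module ℂ W] (a : End ℂ W) : End ℂ W :=
  ∑ n ∈ Finset.range (nilpotencyClass a), (n.factorial : ℂ)⁻¹ • a ^ n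

/-! ### Matrix coefficients of the exponential -/

section Hamiltonians

variable {𝔤 V : Type*} [LieRing 𝔤] [LieAlgebra ℂ 𝔤]
  [AddCommGroup V] [Module ℂ V] [LieRingModule 𝔤 V] [LieModule ℂ 𝔤 V]

/-- The formal power series `⟨ξ, exp (s x) v⟩` in `s = t⁻¹`, for `x` in a Lie algebra acting on
`V`, `v` in `V` and `ξ` in the dual of `V`. -/
def expMatrixCoeff (ξ : Dual ℂ V) (v : V) (x : 𝔤) : PowerSeries ℂ :=
  PowerSeries.mk fun n => ξ (((n.factorial : ℂ)⁻¹ • LieModule.toEnd ℂ 𝔤 V x ^ n) v)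

/-- The order-`n` Hamiltonian as a function: `n!` times the coefficient of `t⁻ⁿ` in
`⟨ξ, exp (t⁻¹ x) v⟩`. -/
def hamiltonianFun (ξ : Dual ℂ V) (v : V) (n : ℕ) (x : 𝔤) : ℂ :=
  (n.factorial : ℂ) * PowerSeries.coeff n (expMatrixCoeff ξ v x)

lemma hamiltonianFun_eq (ξ : Dual ℂ V) (v : V) (n : ℕ) (x : 𝔤) :
    hamiltonianFun ξ v n x = ξ ((LieModule.toEnd ℂ 𝔤 V x ^ n) v) := by
  have h : (n.factorial : ℂ) ≠ 0 := by exact_mod_cast n.factorial_ne_zero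
  simp [hamiltonianFun, expMatrixCoeff, h]

lemma hamiltonianFun_mem_polyFun [FiniteDimensional ℂ V] (ξ : Dual ℂ V) (v : V) (n : ℕ) :
    (hamiltonianFun ξ v n : 𝔤 → ℂ) ∈ polyFun 𝔤 := by
  induction n generalizing ξ with
  | zero =>
    have : (hamiltonianFun ξ v 0 : 𝔤 → ℂ) = algebraMap ℂ (𝔤 → ℂ) (ξ v) := by
      funext x; simp [hamiltonianFun_eq]
    rw [this]; exact Subalgebra.algebraMap_mem _ _
  | succ n ih =>
    let B := Module.finBasis ℂ V
    have : (hamiltonianFun ξ v (n + 1) : 𝔤 → ℂ) =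
        ∑ j, (hamiltonianFun (B.coord j) v n : 𝔤 → ℂ) *
          ((ξ ∘ₗ (LieModule.toEnd ℂ 𝔤 V : 𝔤 →ₗ[ℂ] End ℂ V).flip (B j) : Dual ℂ 𝔤) : 𝔤 → ℂ) := by
      funext x
      rw [hamiltonianFun_eq, pow_succ', Module.End.mul_apply]
      have e := congrArg (fun w => ξ (LieModule.toEnd ℂ 𝔤 V x w))
        (B.sum_repr ((LieModule.toEnd ℂ 𝔤 V x ^ n) v))
      simp only [map_sum, map_smul] at e
      rw [← e]
      simp [hamiltonianFun_eq]
    rw [this]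
    exact Subalgebra.sum_mem _ fun j _ => Subalgebra.mul_mem _ (ih _)
      (Algebra.subset_adjoin ⟨_, rfl⟩)

/-- The order-`n` Hamiltonian as an element of `ℂ[𝔤]`. -/
def hamiltonian [FiniteDimensional ℂ V] (ξ : Dual ℂ V) (v : V) (n : ℕ) : polyFun 𝔤 :=
  ⟨hamiltonianFun ξ v n, hamiltonianFun_mem_polyFun ξ v n⟩

end Hamiltonians

/-! ### Dual Casimir elements -/

/-- The dual Casimir element of a Lie algebra `𝔨` with respect to an invariant bilinear form `β`:
the polynomial function `y ↦ β y y`. For any basis `u` of `𝔨` with `β`-dual basis `u'`, it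
is `∑ₐ uₐ^* · (u'ₐ)^*`, where `^*` denotes coordinate forms; see
`dualCasimir_eq_sum`. -/
def dualCasimir {𝔨 : Type*} [AddCommGroup 𝔨] [Module ℂ 𝔨] (β : LinearMap.BilinForm ℂ 𝔨) (y : 𝔨) :
    ℂ :=
  β y y

lemma dualCasimir_eq_sum {𝔨 ι : Type*} [AddCommGroup 𝔨] [Module ℂ 𝔨] [Fintype ι] [DecidableEq ι]
    (β : LinearMap.BilinForm ℂ 𝔨) (u u' : Basis ι ℂ 𝔨)
    (h : ∀ a c, β (u a) (u' c) = if a = c then 1 else 0) (y : 𝔨) :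
    dualCasimir β y = ∑ a, u.coord a y * u'.coord a y := by
  unfold dualCasimir
  have e₁ : β y y = ∑ a, u.repr y a * β (u a) y := by
    have e := congrArg (fun w => β w y) (u.sum_repr y)
    simp only [map_sum, map_smul, LinearMap.sum_apply, LinearMap.smul_apply, smul_eq_mul] at e
    exact e.symm
  have e₂ : ∀ a, β (u a) y = u'.repr y a := fun a => by
    have e := congrArg (fun w => β (u a) w) (u'.sum_repr y)
    simp only [map_sum, map_smul, smul_eq_mul, h] at e
    simpa using e.symm
  simp [e₁, e₂]

/-! ### Highest and lowest weight vectors, fundamental weights, Levi subalgebras -/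

section Lie

variable {𝔤 : Type*} [LieRing 𝔤] [LieAlgebra ℂ 𝔤] [FiniteDimensional ℂ 𝔤]
  [LieAlgebra.IsSimple ℂ 𝔤] {H : LieSubalgebra ℂ 𝔤} [H.IsCartanSubalgebra]

/-- The set `R⁺` of positive roots with respect to a base. -/
abbrev PosRoot (b : (rootSystem H).Base) : Type _ := {α : H.root // b.IsPos α}

/-- `v` is a highest weight vector of weight `μ`: it spans a line stable under the Borel
subalgebra `𝔟⁺`, on which the Cartan subalgebra acts by `μ`. -/
structure IsHighestWeightVector (b : (rootSystem H).Base) {M : Type*} [AddCommGroup M]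
    [Module ℂ M] [LieRingModule 𝔤 M] (μ : Dual ℂ H) (v : M) : Prop where
  ne_zero : v ≠ 0
  cartan : ∀ h : H, ⁅(h : 𝔤), v⁆ = μ h • v
  pos : ∀ α : PosRoot b, ∀ x ∈ rootSpace H ((rootSystem H).root α.1), ⁅x, v⁆ = 0

/-- `v` is a lowest weight vector of weight `μ`: it spans a line stable under the opposite Borel
subalgebra `𝔟⁻`, on which the Cartan subalgebra acts by `μ`. -/
structure IsLowestWeightVector (b : (rootSystem H).Base) {M : Type*} [AddCommGroup M]
    [Module ℂ M] [LieRingModule 𝔤 M] (μ : Dual ℂ H) (v : M) : Prop where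
  ne_zero : v ≠ 0
  cartan : ∀ h : H, ⁅(h : 𝔤), v⁆ = μ h • v
  neg : ∀ α : PosRoot b, ∀ x ∈ rootSpace H (-(rootSystem H).root α.1), ⁅x, v⁆ = 0

variable (b : (rootSystem H).Base) (i : b.support)

/-- The fundamental weight `ϖ_i`: it takes the value `δ_ij` at the simple coroot `α_j^∨`. -/
def fundamentalWeight : Dual ℂ H := b.toCoweightBasis.coord i

open Classical in
lemma fundamentalWeight_coroot (j : b.support) :
    fundamentalWeight b i ((rootSystem H).coroot j) = if j = i then 1 else 0 := by
  simp [fundamentalWeight, Finsupp.single_apply, -rootSystem_coroot_apply]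

/-- The fundamental coweight `ϖ_i^∨`: the simple root `α_j` takes the value `δ_ij` at it. -/
def fundamentalCoweight : H := (evalEquiv ℂ H).symm (b.toWeightBasis.coord i)

open Classical in
lemma root_fundamentalCoweight (j : b.support) :
    (rootSystem H).root j (fundamentalCoweight b i) = if j = i then 1 else 0 := by
  rw [fundamentalCoweight, apply_evalEquiv_symm_apply]
  simp [Finsupp.single_apply, -rootSystem_root_apply]

/-- `ϖ_i` is cominuscule: the coweight `ϖ_i^∨` is minuscule, i.e. every root takes one of the
values `-1, 0, 1` at it. -/
def IsCominuscule : Prop :=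
  ∀ α : H.root, (rootSystem H).root α (fundamentalCoweight b i) ∈ ({-1, 0, 1} : Set ℂ)

/-- The linear combinations of the simple roots `α_j` with `j ≠ i`. -/
def leviSpan : Submodule ℂ (Dual ℂ H) :=
  Submodule.span ℂ ((fun j : b.support => (rootSystem H).root j) '' {j | j ≠ i})

/-- `R_{P_i}`: the roots that are linear combinations of the simple roots `α_j` with `j ≠ i`. -/
def leviRoots : Set H.root := {α | (rootSystem H).root α ∈ leviSpan b i}

open Classical in
/-- `R⁺ ∖ R_{P_i}`. -/
def nilradicalRoots : Finset (PosRoot b) := Finset.univ.filter fun α => α.1 ∉ leviRoots b i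

/-- The Levi subalgebra `𝔩_i = 𝔥 ⊕ ⨁_{α ∈ R_{P_i}} 𝔤_α`, the Lie algebra of `L_i`. It is
written as the sum of the spaces `𝔤_μ` over all `μ` in the span of the `α_j` with `j ≠ i`; here
`𝔤_0 = 𝔥`, and `𝔤_μ = 0` if `μ` is neither `0` nor a root. -/
def leviSubalgebra : LieSubalgebra ℂ 𝔤 where
  toSubmodule := ⨆ μ : leviSpan b i, (rootSpace H (μ.1 : H → ℂ)).toSubmodule
  lie_mem' := by
    intro x y hx hy
    change x ∈ ⨆ μ : leviSpan b i, (rootSpace H (μ.1 : H → ℂ)).toSubmodule at hx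
    change y ∈ ⨆ μ : leviSpan b i, (rootSpace H (μ.1 : H → ℂ)).toSubmodule at hy
    change ⁅x, y⁆ ∈ ⨆ μ : leviSpan b i, (rootSpace H (μ.1 : H → ℂ)).toSubmodule
    induction hx using Submodule.iSup_induction' with
    | zero => simp
    | add x₁ x₂ _ _ h₁ h₂ => rw [add_lie]; exact add_mem h₁ h₂
    | mem μ x hx =>
      induction hy using Submodule.iSup_induction' with
      | zero => simp
      | add y₁ y₂ _ _ h₁ h₂ => rw [lie_add]; exact add_mem h₁ h₂
      | mem ν y hy =>
        refine Submodule.mem_iSup_of_mem (μ + ν) ?_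
        exact lie_mem_genWeightSpace_of_mem_genWeightSpace hx hy

lemma rootSpace_le_leviSubalgebra {μ : Dual ℂ H} (hμ : μ ∈ leviSpan b i) {x : 𝔤}
    (hx : x ∈ rootSpace H (μ : H → ℂ)) : x ∈ leviSubalgebra b i :=
  Submodule.mem_iSup_of_mem (p := fun μ : leviSpan b i => (rootSpace H (μ.1 : H → ℂ)).toSubmodule)
    ⟨μ, hμ⟩ hx

lemma cartan_le_leviSubalgebra (h : H) : (h : 𝔤) ∈ leviSubalgebra b i :=
  rootSpace_le_leviSubalgebra b i (zero_mem _) (by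
    have : (h : 𝔤) ∈ H.toLieSubmodule := h.2
    rwa [← rootSpace_zero_eq ℂ 𝔤 H] at this)

/-- For a closed symmetric set `Φ` of roots, the adjoint action on `𝔤` of the connected reductive
group with Lie algebra `𝔥 ⊕ ⨁_{α ∈ Φ} 𝔤_α`: the group generated by the maximal torus, i.e. the
automorphisms `exp (ad h)` for `h ∈ 𝔥`, acting on `𝔤_μ` as the scalar `e^{μ(h)}`,
and by the root subgroups `exp (ad y)` for `y ∈ 𝔤_α`, `α ∈ Φ`. -/
def adjointGroup (Φ : Set H.root) : Subgroup (𝔤 ≃ₗ[ℂ] 𝔤) :=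
  Subgroup.closure
    ({φ | ∃ h : H, ∀ μ : Dual ℂ H, ∀ x ∈ rootSpace H (μ : H → ℂ), φ x = Complex.exp (μ h) • x} ∪
     {φ | ∃ α ∈ Φ, ∃ y ∈ rootSpace H ((rootSystem H).root α),
        (φ : 𝔤 →ₗ[ℂ] 𝔤) = nilpotentExp (LieAlgebra.ad ℂ 𝔤 y)})

/-- The invariant form on `𝔤` normalised by `B(α_i^∨, α_i^∨) = 1`, a multiple of the Killing
form. -/
def normalizedForm : LinearMap.BilinForm ℂ 𝔤 :=
  (killingForm ℂ 𝔤 ((rootSystem H).coroot i : H) ((rootSystem H).coroot i : H))⁻¹ • killingForm ℂ 𝔤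

/-! ### Bases of Chevalley type -/

/-- A basis of `𝔤` of Chevalley type: it consists of the simple coroots `h_j = α_j^∨` and, for
every positive root `α`, of root vectors `e_α ∈ 𝔤_α` and `f_α ∈ 𝔤_{-α}` with
`[e_α, f_α] = α^∨`. Every Chevalley basis is of this kind (the integrality of the remaining
structure constants is not asked for). -/
structure ChevalleyTypeBasis where
  /-- the basis: first the `h_j`, then the `e_α`, then the `f_α` -/
  basis : Basis (b.support ⊕ (PosRoot b ⊕ PosRoot b)) ℂ 𝔤
  basis_h : ∀ j : b.support, basis (.inl j) = ((rootSystem H).coroot j : H)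
  basis_e : ∀ α : PosRoot b, basis (.inr (.inl α)) ∈ rootSpace H ((rootSystem H).root α.1)
  basis_f : ∀ α : PosRoot b, basis (.inr (.inr α)) ∈ rootSpace H (-(rootSystem H).root α.1)
  lie_e_f : ∀ α : PosRoot b,
    ⁅basis (.inr (.inl α)), basis (.inr (.inr α))⁆ = ((rootSystem H).coroot α.1 : H)

namespace ChevalleyTypeBasis

variable {b} (C : ChevalleyTypeBasis b)

/-- The coordinate form `e_α^*` of the basis vector `e_α`. -/
def eCoord (α : PosRoot b) : Dual ℂ 𝔤 := C.basis.coord (.inr (.inl α))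

/-- The coordinate form `f_α^*` of the basis vector `f_α`. -/
def fCoord (α : PosRoot b) : Dual ℂ 𝔤 := C.basis.coord (.inr (.inr α))

/-- A weight `μ ∈ 𝔥^*` as a linear form on `𝔤 = 𝔫⁻ ⊕ 𝔥 ⊕ 𝔫⁺`, extended by zero on `𝔫⁻ ⊕ 𝔫⁺`. -/
def weightForm (μ : Dual ℂ H) : Dual ℂ 𝔤 :=
  C.basis.constr ℂ (Sum.elim (fun j => μ ((rootSystem H).coroot j)) fun _ => 0)

open Classical in
/-- The projection of `𝔤` onto the Levi subalgebra `𝔩_i` along the sum of the root spaces `𝔤_α`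
with `α ∉ R_{P_i}`. -/
def leviProj (i : b.support) : 𝔤 →ₗ[ℂ] leviSubalgebra b i :=
  C.basis.constr ℂ (Sum.elim
    (fun j => ⟨((rootSystem H).coroot j : H), cartan_le_leviSubalgebra b i _⟩)
    (Sum.elim
      (fun α => if hα : α.1 ∈ leviRoots b i then
        ⟨C.basis (.inr (.inl α)), rootSpace_le_leviSubalgebra b i hα (C.basis_e α)⟩ else 0)
      (fun α => if hα : α.1 ∈ leviRoots b i then
        ⟨C.basis (.inr (.inr α)), rootSpace_le_leviSubalgebra b i (neg_mem hα) (C.basis_f α)⟩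
        else 0)))

end ChevalleyTypeBasis

end Lie

end

noncomputable section

/-! ### The Killing form, coroots and fundamental (co)weights -/

section Killing

/-! Write κ for the Killing form and κ_α = κ(α^∨, α^∨). The coefficients ⟨v^i, x v_i⟩ and ⟨v^i, x y
v_i⟩ are multilinear, so they are determined on the Chevalley type basis. The e_α kill v_i and the
f_α kill v^i. What survives is the Cartan part and the pairs (e_α, f_α), which contribute ϖ_i(α^∨)
through [e_α, f_α] = α^∨.

The bridge between weights and coweights is 2κ(ϖ_i^∨, h) = κ_{α_i} ϖ_i(h). It gives κ_{α_i} ϖ_i(α^∨)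
= κ_α α(ϖ_i^∨) (`killingForm_mul_fundamentalWeight_coroot`), so ϖ_i(α^∨) = 0 on R_{P_i}. Hence, by
𝔰𝔩₂-theory, v_i and v^i are killed by all 𝔤_α with α ∈ R_{P_i}. For such root vectors y, exp(ad y)
acts on End V by an algebra automorphism that does not change the coefficient at (v^i, v_i). The
torus acts on each coefficient by a difference of weights, here zero. This proves L_i-invariance.

In the cominuscule case α(ϖ_i^∨) = 1 on R⁺ ∖ R_{P_i}, so ϖ_i(α^∨) = κ_α/κ_{α_i} = 2B(e_α, f_α). The
sum in H₂ is therefore the part of B(x, x) that pr_i discards. Absorbing ϖ_i² into the Levi term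
gives β = B − ϖ_i ⊗ ϖ_i. This agrees with B against [𝔩_i, 𝔩_i] because ϖ_i = 2B(ϖ_i^∨, ·) and ϖ_i^∨
is central in 𝔩_i. A nonzero radical would force ϖ_i(ϖ_i^∨) = 1/2, hence 2ϖ_i^∨ = α_i^∨, which
irreducibility of the root system allows only in rank one. -/

lemma killingForm_lie_apply {𝔤 : Type*} [LieRing 𝔤] [LieAlgebra ℂ 𝔤] (x y z : 𝔤) :
    killingForm ℂ 𝔤 ⁅x, y⁆ z = killingForm ℂ 𝔤 x ⁅y, z⁆ :=
  LieModule.traceForm_apply_lie_apply ℂ 𝔤 𝔤 x y z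

lemma killingForm_symm {𝔤 : Type*} [LieRing 𝔤] [LieAlgebra ℂ 𝔤] (x y : 𝔤) :
    killingForm ℂ 𝔤 x y = killingForm ℂ 𝔤 y x :=
  LieModule.traceForm_comm ℂ 𝔤 𝔤 x y

lemma cartan_mem_rootSpace_zero {𝔤 : Type*} [LieRing 𝔤] [LieAlgebra ℂ 𝔤] [FiniteDimensional ℂ 𝔤]
    {H : LieSubalgebra ℂ 𝔤} [H.IsCartanSubalgebra] (h : H) :
    (h : 𝔤) ∈ rootSpace H (0 : H → ℂ) := by
  have : (h : 𝔤) ∈ H.toLieSubmodule := h.2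
  rwa [← rootSpace_zero_eq ℂ 𝔤 H] at this

variable {𝔤 : Type*} [LieRing 𝔤] [LieAlgebra ℂ 𝔤] [FiniteDimensional ℂ 𝔤]
  [LieAlgebra.IsSimple ℂ 𝔤] {H : LieSubalgebra ℂ 𝔤} [H.IsCartanSubalgebra]

/-- κ(α^∨, ·) is proportional to α, and evaluation at α^∨, where α takes the value 2, fixes the
factor. -/
lemma two_mul_killingForm_coroot (α : H.root) (h : H) :
    2 * killingForm ℂ 𝔤 ((rootSystem H).coroot α : H) (h : 𝔤) =
      killingForm ℂ 𝔤 ((rootSystem H).coroot α : H) ((rootSystem H).coroot α : H) *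
        (rootSystem H).root α h := by
  have key (x : H) : killingForm ℂ 𝔤 ((rootSystem H).coroot α : H) (x : 𝔤) =
      2 • (α.1 ((cartanEquivDual H).symm α.1))⁻¹ • α.1 x := traceForm_coroot α.1 x
  have h2 : α.1 ((rootSystem H).coroot α) = 2 :=
    root_apply_coroot (LieSubalgebra.isNonZero_coe_root α)
  rw [key, key, h2]
  simp
  ring

lemma killingForm_coroot_self_ne_zero (α : H.root) :
    killingForm ℂ 𝔤 ((rootSystem H).coroot α : H) ((rootSystem H).coroot α : H) ≠ 0 := by
  intro h0
  have h (x : H) : LieModule.traceForm ℂ H 𝔤 ((rootSystem H).coroot α) x = 0 := by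
    have := two_mul_killingForm_coroot α x
    rw [h0, zero_mul] at this
    exact (mul_eq_zero.mp this).resolve_left two_ne_zero
  exact (rootSystem H).flip.ne_zero α ((traceForm_cartan_nondegenerate ℂ 𝔤 H).1 _ h)

lemma root_ne_zero_fun (α : H.root) : ((rootSystem H).root α : H → ℂ) ≠ 0 := fun h =>
  (rootSystem H).ne_zero α (DFunLike.coe_injective h)

/-- The Killing form pairs `e_α` and `f_α` to half the square length of `α^∨`. -/
lemma two_mul_killingForm_of_lie_eq_coroot (α : H.root) {e f : 𝔤}
    (hf : f ∈ rootSpace H (-(rootSystem H).root α : H → ℂ))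
    (hef : ⁅e, f⁆ = ((rootSystem H).coroot α : H)) :
    2 * killingForm ℂ 𝔤 e f =
      killingForm ℂ 𝔤 ((rootSystem H).coroot α : H) ((rootSystem H).coroot α : H) := by
  have h2 : (rootSystem H).root α ((rootSystem H).coroot α) = 2 :=
    root_apply_coroot (LieSubalgebra.isNonZero_coe_root α)
  have h : ⁅(((rootSystem H).coroot α : H) : 𝔤), f⁆ =
      (-(rootSystem H).root α : H → ℂ) ((rootSystem H).coroot α) • f :=
    lie_eq_smul_of_mem_rootSpace hf _
  rw [Pi.neg_apply, h2] at h
  nth_rw 1 [← hef]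
  rw [killingForm_lie_apply, ← lie_skew, h]
  simp

variable (b : (rootSystem H).Base) (i : b.support)

/-- Both sides are linear in h. At α_j^∨ both equal κ_{α_i} δ_ij, by the proportionality of κ(α_j^∨,
·) and α_j. -/
lemma two_mul_killingForm_fundamentalCoweight (h : H) :
    2 * killingForm ℂ 𝔤 (fundamentalCoweight b i : H) (h : 𝔤) =
      killingForm ℂ 𝔤 ((rootSystem H).coroot i : H) ((rootSystem H).coroot i : H) *
        fundamentalWeight b i h := by
  classical
  let K : H →ₗ[ℂ] H →ₗ[ℂ] ℂ := LieModule.traceForm ℂ H 𝔤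
  have : (2 : ℂ) • K (fundamentalCoweight b i) =
      (killingForm ℂ 𝔤 ((rootSystem H).coroot i : H) ((rootSystem H).coroot i : H)) •
        fundamentalWeight b i := by
    refine b.toCoweightBasis.ext fun j => ?_
    have h1 := two_mul_killingForm_coroot (j : H.root) (fundamentalCoweight b i)
    rw [root_fundamentalCoweight, killingForm_symm] at h1
    rw [RootPairing.Base.toCoweightBasis_apply, LinearMap.smul_apply, LinearMap.smul_apply,
      fundamentalWeight_coroot, smul_eq_mul, smul_eq_mul]
    refine Eq.trans h1 ?_
    split_ifs with hij
    · rw [hij]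
    · simp
  exact LinearMap.congr_fun this h

/-- Two evaluations of 2κ(ϖ_i^∨, α^∨), one from each argument. -/
lemma killingForm_mul_fundamentalWeight_coroot (α : H.root) :
    killingForm ℂ 𝔤 ((rootSystem H).coroot i : H) ((rootSystem H).coroot i : H) *
        fundamentalWeight b i ((rootSystem H).coroot α) =
      killingForm ℂ 𝔤 ((rootSystem H).coroot α : H) ((rootSystem H).coroot α : H) *
        (rootSystem H).root α (fundamentalCoweight b i) := by
  rw [← two_mul_killingForm_fundamentalCoweight, ← two_mul_killingForm_coroot,
    killingForm_symm]

/-- The simple roots form a basis and ϖ_i^∨ is its i-th coordinate, so the span of the others is a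
kernel. All questions about R_{P_i} are thereby reduced to one evaluation. -/
lemma mem_leviSpan_iff (μ : Dual ℂ H) : μ ∈ leviSpan b i ↔ μ (fundamentalCoweight b i) = 0 := by
  have h1 : (fun j : b.support => (rootSystem H).root j) = b.toWeightBasis := by
    funext j; simp [-rootSystem_root_apply]
  rw [leviSpan, h1, Basis.mem_span_image, fundamentalCoweight, apply_evalEquiv_symm_apply]
  constructor
  · intro h
    by_contra h0
    exact h (Finsupp.mem_support_iff.mpr h0) rfl
  · rintro h j hj rfl
    exact Finsupp.mem_support_iff.mp hj h

lemma mem_leviRoots_iff (α : H.root) :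
    α ∈ leviRoots b i ↔ (rootSystem H).root α (fundamentalCoweight b i) = 0 :=
  mem_leviSpan_iff b i _

lemma fundamentalWeight_coroot_eq_zero {α : H.root} (hα : α ∈ leviRoots b i) :
    fundamentalWeight b i ((rootSystem H).coroot α) = 0 := by
  have h := killingForm_mul_fundamentalWeight_coroot b i α
  rw [(mem_leviRoots_iff b i α).mp hα, mul_zero] at h
  exact (mul_eq_zero.mp h).resolve_left (killingForm_coroot_self_ne_zero _)

lemma exists_int_root_fundamentalCoweight (α : H.root) :
    ∃ n : ℤ, (rootSystem H).root α (fundamentalCoweight b i) = n ∧ (b.IsPos α → 0 ≤ n) := by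
  classical
  obtain ⟨f, -, hf, hα⟩ := b.exists_root_eq_sum_int α
  refine ⟨f i, ?_, fun hpos => ?_⟩
  · rw [hα, LinearMap.sum_apply, Finset.sum_eq_single (i : H.root)]
    · have := root_fundamentalCoweight b i i
      rw [if_pos rfl] at this
      rw [LinearMap.smul_apply, this]
      simp
    · intro j hj hji
      have := root_fundamentalCoweight b i ⟨j, hj⟩
      rw [if_neg (fun h => hji (congrArg Subtype.val h))] at this
      rw [LinearMap.smul_apply, this, smul_zero]
    · exact fun h => (h i.2).elim
  · rcases hf with hf | hf
    · exact hf.le _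
    -- Nonpositive coefficients would make the height nonpositive, contradicting positivity of α.
    · have h1 : b.height α ≤ 0 := by
        rw [RootPairing.Base.height_eq_sum hα]
        exact Finset.sum_nonpos fun j _ => hf.le j
      exact absurd hpos (not_lt.mpr h1)

lemma IsCominuscule.root_fundamentalCoweight_eq_one (hi : IsCominuscule b i) {α : PosRoot b}
    (hα : α.1 ∉ leviRoots b i) : (rootSystem H).root α.1 (fundamentalCoweight b i) = 1 := by
  obtain ⟨n, hn, hpos⟩ := exists_int_root_fundamentalCoweight b i α.1
  have h := hi α.1
  simp only [Set.mem_insert_iff, Set.mem_singleton_iff] at h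
  rcases h with h | h | h
  · rw [hn] at h
    have : n = -1 := by exact_mod_cast h
    have := hpos α.2
    lia
  · exact absurd ((mem_leviRoots_iff b i _).mpr h) hα
  · exact h

end Killing

/-! ### Exponentials of nilpotent endomorphisms and matrix coefficients -/

section Exponential

variable {𝔤 V : Type*} [LieRing 𝔤] [LieAlgebra ℂ 𝔤]
  [AddCommGroup V] [Module ℂ V] [LieRingModule 𝔤 V] [LieModule ℂ 𝔤 V]

lemma nilpotentExp_eq_sum {W : Type*} [AddCommGroup W] [Module ℂ W] {a : End ℂ W} {k : ℕ}
    (h : a ^ k = 0) : nilpotentExp a = ∑ n ∈ Finset.range k, (n.factorial : ℂ)⁻¹ • a ^ n := by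
  have hle : nilpotencyClass a ≤ k := csInf_le' h
  refine Finset.sum_subset (Finset.range_mono hle) fun n _ hn => ?_
  rw [pow_eq_zero_of_le (by simpa using hn) (pow_nilpotencyClass ⟨k, h⟩), smul_zero]

lemma nilpotentExp_eq_exp {W : Type*} [AddCommGroup W] [Module ℂ W] [Module ℚ W] (a : End ℂ W) :
    nilpotentExp a = IsNilpotent.exp a := by
  refine Finset.sum_congr rfl fun n _ => ?_
  ext w
  have := Rat.cast_smul_eq_qsmul ℂ ((n.factorial : ℚ)⁻¹) ((a ^ n) w)
  rw [LinearMap.smul_apply, LinearMap.smul_apply, ← this]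
  simp

/-- The exponential of a nilpotent derivation is multiplicative. -/
lemma nilpotentExp_pow_of_derivation {A : Type*} [Ring A] [Algebra ℂ A] (D : A →ₗ[ℂ] A)
    (hD : ∀ x y, D (x * y) = x * D y + D x * y) (hnil : IsNilpotent D) (x : A) (n : ℕ) :
    nilpotentExp D (x ^ (n + 1)) = nilpotentExp D x ^ (n + 1) := by
  -- `IsNilpotent.exp` is defined with rational scalars.
  let _ : Module ℚ A := Module.compHom A (algebraMap ℚ ℂ)
  induction n with
  | zero => simp
  | succ n ih =>
    rw [pow_succ x, pow_succ (nilpotentExp D x), ← ih, nilpotentExp_eq_exp]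
    exact Module.End.exp_mul_of_derivation ℂ A D hD hnil _ _

lemma nilpotentExp_intertwine {W W' : Type*} [AddCommGroup W] [Module ℂ W] [AddCommGroup W']
    [Module ℂ W'] {a : End ℂ W} {c : End ℂ W'} (ha : IsNilpotent a) (hc : IsNilpotent c)
    (g : W →ₗ[ℂ] W') (h : c ∘ₗ g = g ∘ₗ a) (w : W) :
    nilpotentExp c (g w) = g (nilpotentExp a w) := by
  let _ : Module ℚ W := Module.compHom W (algebraMap ℚ ℂ)
  let _ : Module ℚ W' := Module.compHom W' (algebraMap ℚ ℂ)
  rw [nilpotentExp_eq_exp, nilpotentExp_eq_exp]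
  exact LinearMap.congr_fun (Module.End.commute_exp_left_of_commute ha hc h) w

/-- If `y` kills both `v` and `ξ`, then the matrix coefficients `⟨ξ, xⁿ v⟩` are invariant under
`exp (ad y)`. -/
lemma hamiltonianFun_nilpotentExp_ad {ξ : Dual ℂ V} {v : V} {y : 𝔤}
    (hy : IsNilpotent (LieAlgebra.ad ℂ 𝔤 y)) (hyV : IsNilpotent (LieModule.toEnd ℂ 𝔤 V y))
    (hv : ⁅y, v⁆ = 0) (hξ : ⁅y, ξ⁆ = 0) (n : ℕ) (x : 𝔤) :
    hamiltonianFun ξ v n (nilpotentExp (LieAlgebra.ad ℂ 𝔤 y) x) = hamiltonianFun ξ v n x := by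
  rcases n with _ | n
  · simp [hamiltonianFun_eq]
  set Y := LieModule.toEnd ℂ 𝔤 V y
  -- The commutator with Y, as a difference of two commuting nilpotent operators; hence nilpotent.
  -- It is also a derivation, so its exponential passes through powers.
  let D : End ℂ V →ₗ[ℂ] End ℂ V := LinearMap.mulLeft ℂ Y - LinearMap.mulRight ℂ Y
  have hDapp (Z : End ℂ V) : D Z = Y * Z - Z * Y := by
    simp [D]
  have hD : IsNilpotent D := (LinearMap.commute_mulLeft_right Y Y).isNilpotent_sub
    ((LinearMap.isNilpotent_mulLeft_iff ℂ Y).mpr hyV)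
    ((LinearMap.isNilpotent_mulRight_iff ℂ Y).mpr hyV)
  have hcomm : D ∘ₗ (LieModule.toEnd ℂ 𝔤 V : 𝔤 →ₗ[ℂ] End ℂ V) =
      (LieModule.toEnd ℂ 𝔤 V : 𝔤 →ₗ[ℂ] End ℂ V) ∘ₗ (LieAlgebra.ad ℂ 𝔤 y : End ℂ 𝔤) := by
    ext z : 1
    ext w
    simp [hDapp, Y]
  have h1 := nilpotentExp_intertwine hy hD _ hcomm x
  simp only [LieHom.coe_toLinearMap] at h1
  rw [hamiltonianFun_eq, hamiltonianFun_eq, ← h1, ← nilpotentExp_pow_of_derivation D _ hD]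
  · obtain ⟨k, hk⟩ := hD
    have hD0 (Z : End ℂ V) : ξ (D Z v) = 0 := by
      have h2 : ξ (Y (Z v)) = 0 := by
        have := LinearMap.congr_fun hξ (Z v)
        simpa [Y] using this
      have h3 : Y v = 0 := hv
      rw [hDapp, LinearMap.sub_apply, Module.End.mul_apply, Module.End.mul_apply, h3, map_sub, h2]
      simp
    -- Truncating at k + 1 makes the range nonempty, so that the identity term splits off. Every
    -- other term lies in the image of D and is killed by `hD0`.
    rw [nilpotentExp_eq_sum (pow_eq_zero_of_le (Nat.le_succ k) hk), Finset.sum_range_succ']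
    simp [pow_succ', hD0]
  · intro Z Z'
    simp only [hDapp]
    noncomm_ring

end Exponential

/-! ### Weight vectors -/

section Weights

lemma apply_eq_zero_of_weight_ne {𝔤 : Type*} [LieRing 𝔤] [LieAlgebra ℂ 𝔤]
    {H : LieSubalgebra ℂ 𝔤} {V : Type*} [AddCommGroup V] [Module ℂ V] [LieRingModule 𝔤 V]
    {μ ν : H → ℂ} {ξ : Dual ℂ V} {w : V}
    (hξ : ∀ (h : H) (u : V), ξ ⁅(h : 𝔤), u⁆ = μ h * ξ u)
    (hw : ∀ h : H, ⁅(h : 𝔤), w⁆ = ν h • w) (hne : ν ≠ μ) : ξ w = 0 := by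
  obtain ⟨h, hh⟩ := Function.ne_iff.mp hne
  have h1 := hξ h w
  rw [hw, map_smul, smul_eq_mul] at h1
  by_contra h0
  exact hh (mul_right_cancel₀ h0 h1)

variable {𝔤 : Type*} [LieRing 𝔤] [LieAlgebra ℂ 𝔤] [FiniteDimensional ℂ 𝔤]
  [LieAlgebra.IsSimple ℂ 𝔤] {H : LieSubalgebra ℂ 𝔤} [H.IsCartanSubalgebra]
  {V : Type*} [AddCommGroup V] [Module ℂ V] [LieRingModule 𝔤 V] [LieModule ℂ 𝔤 V]

lemma lie_lie_of_mem_rootSpace {μ ν : H → ℂ} {x : 𝔤} {w : V} (hx : x ∈ rootSpace H μ)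
    (hw : ∀ h : H, ⁅(h : 𝔤), w⁆ = ν h • w) (h : H) :
    ⁅(h : 𝔤), ⁅x, w⁆⁆ = (μ + ν) h • ⁅x, w⁆ := by
  have h1 : ⁅(h : 𝔤), x⁆ = μ h • x := lie_eq_smul_of_mem_rootSpace hx h
  rw [leibniz_lie, h1, hw, smul_lie, lie_smul, Pi.add_apply, add_smul]

namespace ChevalleyTypeBasis

variable {b : (rootSystem H).Base} (C : ChevalleyTypeBasis b)

/-- The weight of a vector of a Chevalley type basis under the Cartan subalgebra. -/
def weight (b : (rootSystem H).Base) : b.support ⊕ (PosRoot b ⊕ PosRoot b) → Dual ℂ H :=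
  Sum.elim (fun _ => 0)
    (Sum.elim (fun α => (rootSystem H).root α.1) (fun α => -(rootSystem H).root α.1))

lemma basis_mem_rootSpace (k : b.support ⊕ (PosRoot b ⊕ PosRoot b)) :
    C.basis k ∈ rootSpace H (weight b k : H → ℂ) := by
  rcases k with j | α | α
  · rw [C.basis_h]
    exact cartan_mem_rootSpace_zero _
  · exact C.basis_e α
  · exact C.basis_f α

/-- A basis vector of weight λ is rescaled by e^{λ(h)} and moves w from weight ν to λ + ν, so the
factor e^{(μ − ν)(h)} is preserved by induction over all weight vectors w. At n = 0 either ν = μ or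
both sides vanish. -/
lemma apply_toEnd_pow_torus (C : ChevalleyTypeBasis b) {ξ : Dual ℂ V} {μ : H → ℂ}
    (hξ : ∀ (h : H) (u : V), ξ ⁅(h : 𝔤), u⁆ = μ h * ξ u) {φ : 𝔤 ≃ₗ[ℂ] 𝔤} {h : H}
    (hφ : ∀ ν : Dual ℂ H, ∀ x ∈ rootSpace H (ν : H → ℂ), φ x = Complex.exp (ν h) • x)
    (n : ℕ) (x : 𝔤) {ν : H → ℂ} {w : V} (hw : ∀ h : H, ⁅(h : 𝔤), w⁆ = ν h • w) :
    ξ ((LieModule.toEnd ℂ 𝔤 V (φ x) ^ n) w) =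
      Complex.exp (μ h - ν h) * ξ ((LieModule.toEnd ℂ 𝔤 V x ^ n) w) := by
  classical
  induction n generalizing ν w with
  | zero =>
    by_cases hne : ν = μ
    · simp [hne]
    · simp [apply_eq_zero_of_weight_ne hξ hw hne]
  | succ n ih =>
    simp only [pow_succ, Module.End.mul_apply, LieModule.toEnd_apply_apply]
    have hφx : ⁅φ x, w⁆ =
        ∑ k, (C.basis.repr x k * Complex.exp (weight b k h)) • ⁅C.basis k, w⁆ := by
      conv_lhs => rw [← C.basis.sum_repr x]
      simp only [map_sum, map_smul, hφ _ _ (C.basis_mem_rootSpace _), sum_lie, smul_lie, mul_smul]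
    have hx : ⁅x, w⁆ = ∑ k, C.basis.repr x k • ⁅C.basis k, w⁆ := by
      conv_lhs => rw [← C.basis.sum_repr x]
      simp only [sum_lie, smul_lie]
    rw [hφx, hx, map_sum, map_sum, map_sum, map_sum, Finset.mul_sum]
    refine Finset.sum_congr rfl fun k _ => ?_
    rw [map_smul, map_smul, map_smul, map_smul,
      ih (lie_lie_of_mem_rootSpace (C.basis_mem_rootSpace k) hw)]
    have : Complex.exp (weight b k h) * Complex.exp (μ h - (weight b k h + ν h)) =
        Complex.exp (μ h - ν h) := by
      rw [← Complex.exp_add]; ring_nf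
    simp only [smul_eq_mul, Pi.add_apply, ← this]
    ring

end ChevalleyTypeBasis
end Weights

/-! ### The Hamiltonians of order one and two, and their invariance -/

section LowOrder

variable {𝔤 : Type*} [LieRing 𝔤] [LieAlgebra ℂ 𝔤] [FiniteDimensional ℂ 𝔤]
  [LieAlgebra.IsSimple ℂ 𝔤] {H : LieSubalgebra ℂ 𝔤} [H.IsCartanSubalgebra]
  {V : Type*} [AddCommGroup V] [Module ℂ V] [LieRingModule 𝔤 V] [LieModule ℂ 𝔤 V]
  {b : (rootSystem H).Base}

lemma IsLowestWeightVector.apply_lie_cartan {μ : Dual ℂ H} {ξ : Dual ℂ V}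
    (hξ : IsLowestWeightVector b (-μ) ξ) (h : H) (u : V) :
    ξ ⁅(h : 𝔤), u⁆ = μ h * ξ u := by
  have := LinearMap.congr_fun (hξ.cartan h) u
  simpa using this

lemma IsLowestWeightVector.apply_lie_neg {μ : Dual ℂ H} {ξ : Dual ℂ V}
    (hξ : IsLowestWeightVector b μ ξ) (α : PosRoot b) {x : 𝔤}
    (hx : x ∈ rootSpace H (-(rootSystem H).root α.1 : H → ℂ)) (u : V) : ξ ⁅x, u⁆ = 0 := by
  have := LinearMap.congr_fun (hξ.neg α x hx) u
  simpa using this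

namespace ChevalleyTypeBasis

variable (C : ChevalleyTypeBasis b)

@[simp] lemma weightForm_h (μ : Dual ℂ H) (j : b.support) :
    C.weightForm μ (C.basis (.inl j)) = μ ((rootSystem H).coroot j) := by
  rw [weightForm, Basis.constr_basis, Sum.elim_inl]

@[simp] lemma weightForm_inr (μ : Dual ℂ H) (k : PosRoot b ⊕ PosRoot b) :
    C.weightForm μ (C.basis (.inr k)) = 0 := by
  rw [weightForm, Basis.constr_basis, Sum.elim_inr]

open Classical in
lemma eCoord_basis (α : PosRoot b) (k) :
    C.eCoord α (C.basis k) = if k = .inr (.inl α) then 1 else 0 := by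
  simp [eCoord, Finsupp.single_apply]

open Classical in
lemma fCoord_basis (α : PosRoot b) (k) :
    C.fCoord α (C.basis k) = if k = .inr (.inr α) then 1 else 0 := by
  simp [fCoord, Finsupp.single_apply]

variable {μ : Dual ℂ H} {v : V} {ξ : Dual ℂ V}

lemma apply_lie_eq_weightForm (hv : IsHighestWeightVector b μ v)
    (hξ : IsLowestWeightVector b (-μ) ξ) (hξv : ξ v = 1) (x : 𝔤) :
    ξ ⁅x, v⁆ = C.weightForm μ x := by
  have : ξ ∘ₗ (LieModule.toEnd ℂ 𝔤 V : 𝔤 →ₗ[ℂ] End ℂ V).flip v = C.weightForm μ := by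
    refine C.basis.ext fun k => ?_
    change ξ ⁅C.basis k, v⁆ = _
    rcases k with j | α | α
    · rw [weightForm_h, C.basis_h, hv.cartan, map_smul, hξv, smul_eq_mul, mul_one]
    · rw [weightForm_inr, hv.pos α _ (C.basis_e α), map_zero]
    · rw [weightForm_inr, hξ.apply_lie_neg α (C.basis_f α)]
  exact LinearMap.congr_fun this x

open Classical in
-- For α = β, commute e_α past f_α. For α ≠ β, the vector has weight α − β + μ ≠ μ, which ξ does not
-- see.
lemma apply_lie_e_lie_f (hv : IsHighestWeightVector b μ v)
    (hξ : IsLowestWeightVector b (-μ) ξ) (hξv : ξ v = 1) (α β : PosRoot b) :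
    ξ ⁅C.basis (.inr (.inl α)), ⁅C.basis (.inr (.inr β)), v⁆⁆ =
      if α = β then μ ((rootSystem H).coroot β.1) else 0 := by
  split_ifs with h
  · subst h
    rw [leibniz_lie, C.lie_e_f, hv.pos α _ (C.basis_e α), lie_zero, add_zero, hv.cartan, map_smul,
      hξv, smul_eq_mul, mul_one]
  · have h1 := lie_lie_of_mem_rootSpace (C.basis_e α)
      (lie_lie_of_mem_rootSpace (C.basis_f β) hv.cartan)
    refine apply_eq_zero_of_weight_ne hξ.apply_lie_cartan h1 fun h0 => h ?_
    have h2 : ((rootSystem H).root α.1 : H → ℂ) = (rootSystem H).root β.1 := by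
      rw [← add_assoc, add_eq_right, ← sub_eq_add_neg, sub_eq_zero] at h0
      exact h0
    exact Subtype.ext ((rootSystem H).root.injective (DFunLike.coe_injective h2))

/-- The polarised form of the quadratic Hamiltonian: being bilinear in (x, y), it can be checked on
pairs of basis vectors. -/
lemma apply_lie_lie_eq (i : b.support) (hv : IsHighestWeightVector b (fundamentalWeight b i) v)
    (hξ : IsLowestWeightVector b (-fundamentalWeight b i) ξ) (hξv : ξ v = 1) (x y : 𝔤) :
    ξ ⁅x, ⁅y, v⁆⁆ = C.weightForm (fundamentalWeight b i) x * C.weightForm (fundamentalWeight b i) y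
      + ∑ α ∈ nilradicalRoots b i,
          fundamentalWeight b i ((rootSystem H).coroot α.1) * C.eCoord α x * C.fCoord α y := by
  classical
  let ϖ := fundamentalWeight b i
  let T : 𝔤 →ₗ[ℂ] V →ₗ[ℂ] V := (LieModule.toEnd ℂ 𝔤 V : 𝔤 →ₗ[ℂ] End ℂ V)
  let Φ : 𝔤 →ₗ[ℂ] 𝔤 →ₗ[ℂ] ℂ := (T.compr₂ ξ).compl₂ (T.flip v)
  let Ψ : 𝔤 →ₗ[ℂ] 𝔤 →ₗ[ℂ] ℂ := (C.weightForm ϖ).smulRight (C.weightForm ϖ) +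
    ∑ α ∈ nilradicalRoots b i,
      ϖ ((rootSystem H).coroot α.1) • (C.eCoord α).smulRight (C.fCoord α)
  have hΨ (x y : 𝔤) : Ψ x y = C.weightForm ϖ x * C.weightForm ϖ y + ∑ α ∈ nilradicalRoots b i,
      ϖ ((rootSystem H).coroot α.1) * C.eCoord α x * C.fCoord α y := by
    simp [Ψ, LinearMap.sum_apply, mul_assoc]
  have key : Φ = Ψ := by
    refine C.basis.ext fun k => C.basis.ext fun l => ?_
    rw [hΨ]
    change ξ ⁅C.basis k, ⁅C.basis l, v⁆⁆ = _
    rcases l with j | β | β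
    · rw [C.basis_h, hv.cartan, lie_smul, map_smul, C.apply_lie_eq_weightForm hv hξ hξv, ← C.basis_h]
      simp [fCoord_basis, ϖ, mul_comm]
    · rw [hv.pos β _ (C.basis_e β)]
      simp [fCoord_basis]
    · rcases k with j | α | α
      · rw [C.basis_h, hξ.apply_lie_cartan, hξ.apply_lie_neg β (C.basis_f β), ← C.basis_h]
        simp [eCoord_basis]
      · rw [C.apply_lie_e_lie_f hv hξ hξv]
        simp only [weightForm_inr, eCoord_basis, fCoord_basis, mul_zero, zero_add, Sum.inr.injEq,
          Sum.inl.injEq, mul_ite, mul_one]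
        rw [Finset.sum_ite_eq]
        -- Roots of the Levi are missing from the sum, harmlessly: ϖ_i vanishes on their coroots.
        by_cases hβ : β.1 ∈ leviRoots b i
        · simp [nilradicalRoots, hβ, fundamentalWeight_coroot_eq_zero, -rootSystem_coroot_apply]
        · simp [nilradicalRoots, hβ, ϖ]
      · rw [hξ.apply_lie_neg α (C.basis_f α)]
        simp [eCoord_basis]
  rw [← hΨ, ← key]
  rfl

end ChevalleyTypeBasis

end LowOrder

/-! ### Invariance under the Levi group -/

section Invariance

variable {𝔤 : Type*} [LieRing 𝔤] [LieAlgebra ℂ 𝔤] [FiniteDimensional ℂ 𝔤]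
  [LieAlgebra.IsSimple ℂ 𝔤] {H : LieSubalgebra ℂ 𝔤} [H.IsCartanSubalgebra]
  {V : Type*} [AddCommGroup V] [Module ℂ V] [LieRingModule 𝔤 V] [LieModule ℂ 𝔤 V]
  [FiniteDimensional ℂ V] {b : (rootSystem H).Base}

lemma pos_or_exists_neg (b : (rootSystem H).Base) (α : H.root) :
    b.IsPos α ∨ ∃ β : PosRoot b, (rootSystem H).root α = -(rootSystem H).root β.1 := by
  let := (rootSystem H).indexNeg
  refine (RootPairing.Base.IsPos.or_neg b α).imp_right fun h => ⟨⟨-α, h⟩, ?_⟩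
  change _ = -(rootSystem H).root (-α)
  rw [RootPairing.indexNeg_neg, RootPairing.root_reflectionPerm,
    RootPairing.reflection_apply_self, neg_neg]

/-- A vector of weight zero for a coroot that is killed by one of the two root spaces
`𝔤_{±α}` is killed by the other one as well. -/
lemma lie_eq_zero_of_lie_coroot_eq_zero (α : H.root) {w : V} (hw : w ≠ 0)
    (hh : ⁅(((rootSystem H).coroot α : H) : 𝔤), w⁆ = 0)
    (hpos : ∀ x ∈ rootSpace H ((rootSystem H).root α : H → ℂ), ⁅x, w⁆ = 0)
    {y : 𝔤} (hy : y ∈ rootSpace H (-(rootSystem H).root α : H → ℂ)) : ⁅y, w⁆ = 0 := by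
  have hα : (α.1).IsNonZero := LieSubalgebra.isNonZero_coe_root α
  obtain ⟨h, e, f, ht, he, hf⟩ := exists_isSl2Triple_of_weight_isNonZero hα
  have hcoroot := ht.h_eq_coroot hα he hf
  -- w is primitive of weight 0 for this 𝔰𝔩₂, so f already kills it; y is a multiple of f because
  -- root spaces are lines.
  have P : ht.HasPrimitiveVectorWith w (0 : ℂ) :=
    ⟨hw, by rw [zero_smul, hcoroot]; exact hh, hpos e he⟩
  have h1 := P.pow_toEnd_f_eq_zero_of_eq_nat (n := 0) (by simp)
  have h2 : ⁅f, w⁆ = 0 := by simpa using h1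
  have hrank := finrank_rootSpace_eq_one (-α.1) (LieModule.Weight.isNonZero_neg.mpr hα)
  obtain ⟨c, hc⟩ := (finrank_eq_one_iff_of_nonzero' (⟨f, hf⟩ : rootSpace H (-α.1))
    (fun h0 => ht.f_ne_zero (congrArg Subtype.val h0))).mp hrank ⟨y, hy⟩
  have hc' : c • f = y := congrArg Subtype.val hc
  rw [← hc', smul_lie, h2, smul_zero]

lemma isNilpotent_toEnd_of_mem_rootSpace_root (M : Type*) [AddCommGroup M] [Module ℂ M] [LieRingModule 𝔤 M]
    [LieModule ℂ 𝔤 M] [FiniteDimensional ℂ M] (α : H.root) {y : 𝔤}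
    (hy : y ∈ rootSpace H ((rootSystem H).root α : H → ℂ)) :
    IsNilpotent (LieModule.toEnd ℂ 𝔤 M y) :=
  LieModule.isNilpotent_toEnd_of_mem_rootSpace M H (root_ne_zero_fun α) hy

variable {i : b.support} {v : V} {ξ : Dual ℂ V}

/-- Only negative α = −β need an argument: v has weight ϖ_i(β^∨) = 0 for the 𝔰𝔩₂ of β and is killed
by 𝔤_β, hence also by 𝔤_{−β}. -/
lemma IsHighestWeightVector.lie_eq_zero_of_mem_leviRoots
    (hv : IsHighestWeightVector b (fundamentalWeight b i) v) {α : H.root}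
    (hα : α ∈ leviRoots b i) {y : 𝔤} (hy : y ∈ rootSpace H ((rootSystem H).root α : H → ℂ)) :
    ⁅y, v⁆ = 0 := by
  rcases pos_or_exists_neg b α with h | ⟨β, hβ⟩
  · exact hv.pos ⟨α, h⟩ y hy
  · have hβ' : β.1 ∈ leviRoots b i := by
      rw [mem_leviRoots_iff] at hα ⊢
      simpa [hβ, -rootSystem_root_apply] using hα
    refine lie_eq_zero_of_lie_coroot_eq_zero β.1 hv.ne_zero ?_ (hv.pos β) (by rwa [hβ] at hy)
    rw [hv.cartan, fundamentalWeight_coroot_eq_zero b i hβ', zero_smul]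

lemma IsLowestWeightVector.lie_eq_zero_of_mem_leviRoots
    (hξ : IsLowestWeightVector b (-fundamentalWeight b i) ξ) {α : H.root}
    (hα : α ∈ leviRoots b i) {y : 𝔤} (hy : y ∈ rootSpace H ((rootSystem H).root α : H → ℂ)) :
    ⁅y, ξ⁆ = 0 := by
  rcases pos_or_exists_neg b α with h | ⟨β, hβ⟩
  · let := (rootSystem H).indexNeg
    have hneg : (rootSystem H).root (-α) = -(rootSystem H).root α := by
      rw [RootPairing.indexNeg_neg, RootPairing.root_reflectionPerm,
        RootPairing.reflection_apply_self]
    have hcoroot : (rootSystem H).coroot (-α) = -(rootSystem H).coroot α := by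
      rw [RootPairing.indexNeg_neg, RootPairing.coroot_reflectionPerm,
        RootPairing.coreflection_apply_self]
    -- The 𝔰𝔩₂ argument is applied to −α, since ξ is known to be killed by the negative root spaces.
    refine lie_eq_zero_of_lie_coroot_eq_zero (V := Dual ℂ V) (-α) hξ.ne_zero ?_
      (fun x hx => hξ.neg ⟨α, h⟩ x (by rwa [hneg] at hx)) (by
        rw [hneg]
        have : (-⇑(-(rootSystem H).root α) : H → ℂ) = (rootSystem H).root α := by
          funext; simp
        rwa [this])
    rw [hξ.cartan, hcoroot, map_neg, LinearMap.neg_apply,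
      fundamentalWeight_coroot_eq_zero b i hα]
    simp
  · exact hξ.neg β y (by rwa [hβ] at hy)

theorem hamiltonian_mem_polyInvariants (C : ChevalleyTypeBasis b)
    (hv : IsHighestWeightVector b (fundamentalWeight b i) v)
    (hξ : IsLowestWeightVector b (-fundamentalWeight b i) ξ) (n : ℕ) :
    (hamiltonian ξ v n : polyFun 𝔤) ∈ polyInvariants (adjointGroup (leviRoots b i)) := by
  intro φ hφ
  change ∀ x : 𝔤, hamiltonianFun ξ v n (φ x) = hamiltonianFun ξ v n x
  induction hφ using Subgroup.closure_induction with
  | mem φ hφ =>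
    intro x
    rcases hφ with ⟨h, hφ⟩ | ⟨α, hα, y, hy, hφ⟩
    · rw [hamiltonianFun_eq, hamiltonianFun_eq,
        C.apply_toEnd_pow_torus hξ.apply_lie_cartan hφ n x hv.cartan]
      simp
    · have h1 : φ x = nilpotentExp (LieAlgebra.ad ℂ 𝔤 y) x := LinearMap.congr_fun hφ x
      rw [h1]
      exact hamiltonianFun_nilpotentExp_ad (isNilpotent_toEnd_of_mem_rootSpace_root 𝔤 α hy)
        (isNilpotent_toEnd_of_mem_rootSpace_root V α hy) (hv.lie_eq_zero_of_mem_leviRoots hα hy)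
        (hξ.lie_eq_zero_of_mem_leviRoots hα hy) n x
  | one => exact fun x => rfl
  | mul φ ψ _ _ h1 h2 => exact fun x => (h1 (ψ x)).trans (h2 x)
  | inv φ _ h1 =>
    intro x
    rw [← h1 (φ⁻¹ x)]
    congr 1
    exact φ.apply_symm_apply x

end Invariance

/-! ### The projection to the Levi subalgebra and the normalised form -/

section Levi

variable {𝔤 : Type*} [LieRing 𝔤] [LieAlgebra ℂ 𝔤] [FiniteDimensional ℂ 𝔤]
  [LieAlgebra.IsSimple ℂ 𝔤] {H : LieSubalgebra ℂ 𝔤} [H.IsCartanSubalgebra]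
  {b : (rootSystem H).Base}

/-- ϖ_i^∨ acts on 𝔤_μ by μ(ϖ_i^∨), which is zero for μ in the span of the α_j with j ≠ i. -/
lemma lie_fundamentalCoweight_of_mem_leviSubalgebra (i : b.support) {y : 𝔤}
    (hy : y ∈ leviSubalgebra b i) : ⁅(fundamentalCoweight b i : 𝔤), y⁆ = 0 := by
  change y ∈ ⨆ μ : leviSpan b i, (rootSpace H (μ.1 : H → ℂ)).toSubmodule at hy
  induction hy using Submodule.iSup_induction' with
  | zero => simp
  | add y₁ y₂ _ _ h₁ h₂ => rw [lie_add, h₁, h₂, add_zero]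
  | mem μ y hy =>
    have h : ⁅(fundamentalCoweight b i : 𝔤), y⁆ = μ.1 (fundamentalCoweight b i) • y :=
      lie_eq_smul_of_mem_rootSpace hy _
    rw [h, (mem_leviSpan_iff b i _).mp μ.2, zero_smul]

namespace ChevalleyTypeBasis

variable (C : ChevalleyTypeBasis b) (i : b.support)

open Classical in
lemma leviProj_basis (k : b.support ⊕ (PosRoot b ⊕ PosRoot b)) :
    (C.leviProj i (C.basis k) : 𝔤) = if weight b k ∈ leviSpan b i then C.basis k else 0 := by
  rw [leviProj, Basis.constr_basis]
  rcases k with j | α | α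
  · have : weight b (.inl j) ∈ leviSpan b i := zero_mem _
    rw [if_pos this, C.basis_h, Sum.elim_inl]
  · by_cases h : α.1 ∈ leviRoots b i
    · have : weight b (.inr (.inl α)) ∈ leviSpan b i := h
      rw [if_pos this]
      simp [h]
    · have : weight b (.inr (.inl α)) ∉ leviSpan b i := h
      rw [if_neg this]
      simp [h]
  · by_cases h : α.1 ∈ leviRoots b i
    · have : weight b (.inr (.inr α)) ∈ leviSpan b i := neg_mem h
      rw [if_pos this]
      simp [h]
    · have : weight b (.inr (.inr α)) ∉ leviSpan b i := fun h' => h (neg_mem_iff.mp h')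
      rw [if_neg this]
      simp [h]

lemma killingForm_basis_eq_zero {k l : b.support ⊕ (PosRoot b ⊕ PosRoot b)}
    (h : weight b k + weight b l ≠ 0) : killingForm ℂ 𝔤 (C.basis k) (C.basis l) = 0 :=
  killingForm_apply_eq_zero_of_mem_rootSpace_of_add_ne_zero ℂ 𝔤 H (C.basis_mem_rootSpace k)
    (C.basis_mem_rootSpace l) fun h0 => h (DFunLike.coe_injective h0)

open Classical in
/-- The Killing form minus its pullback from the Levi subalgebra, on a pair of basis vectors. -/
lemma killingForm_sub_leviProj_basis (k l : b.support ⊕ (PosRoot b ⊕ PosRoot b)) :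
    killingForm ℂ 𝔤 (C.basis k) (C.basis l) -
        killingForm ℂ 𝔤 (C.leviProj i (C.basis k)) (C.leviProj i (C.basis l)) =
      if weight b k ∈ leviSpan b i then 0 else killingForm ℂ 𝔤 (C.basis k) (C.basis l) := by
  rw [leviProj_basis, leviProj_basis]
  by_cases hk : weight b k ∈ leviSpan b i
  · by_cases hl : weight b l ∈ leviSpan b i
    · simp [hk, hl]
    · have : killingForm ℂ 𝔤 (C.basis k) (C.basis l) = 0 :=
        C.killingForm_basis_eq_zero fun h => hl ((add_mem_cancel_left hk).mp (h ▸ zero_mem _))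
      rw [if_pos hk, if_pos hk, if_neg hl, this, map_zero, sub_zero]
  · simp [hk]

/-- Extension by zero off 𝔥 is what pairing with ϖ_i^∨ does, as 𝔥 is orthogonal to the root spaces.
This makes invariance of κ available for ϖ_i. -/
lemma weightForm_fundamentalWeight (x : 𝔤) :
    killingForm ℂ 𝔤 ((rootSystem H).coroot i : H) ((rootSystem H).coroot i : H) *
        C.weightForm (fundamentalWeight b i) x =
      2 * killingForm ℂ 𝔤 (fundamentalCoweight b i : H) x := by
  have key : killingForm ℂ 𝔤 ((rootSystem H).coroot i : H) ((rootSystem H).coroot i : H) •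
      C.weightForm (fundamentalWeight b i) =
        (2 : ℂ) • killingForm ℂ 𝔤 (fundamentalCoweight b i : H) := by
    refine C.basis.ext fun k => ?_
    rw [LinearMap.smul_apply, LinearMap.smul_apply, smul_eq_mul, smul_eq_mul]
    have aux (k : PosRoot b ⊕ PosRoot b) :
        killingForm ℂ 𝔤 (fundamentalCoweight b i : H) (C.basis (.inr k)) = 0 := by
      refine killingForm_apply_eq_zero_of_mem_rootSpace_of_add_ne_zero ℂ 𝔤 H
        (cartan_mem_rootSpace_zero _) (C.basis_mem_rootSpace _) ?_
      rw [zero_add]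
      rcases k with α | α
      · exact root_ne_zero_fun α.1
      · exact neg_ne_zero.mpr (root_ne_zero_fun α.1)
    rcases k with j | k
    · rw [weightForm_h, C.basis_h, two_mul_killingForm_fundamentalCoweight]
    · rw [weightForm_inr, aux, mul_zero, mul_zero]
  exact LinearMap.congr_fun key x

/-- The Killing form minus its pullback from the Levi subalgebra, as a quadratic form. -/
lemma killingForm_self_sub_leviProj (x : 𝔤) :
    killingForm ℂ 𝔤 x x - killingForm ℂ 𝔤 (C.leviProj i x) (C.leviProj i x) =
      ∑ α ∈ nilradicalRoots b i,
        killingForm ℂ 𝔤 ((rootSystem H).coroot α.1 : H) ((rootSystem H).coroot α.1 : H) *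
          C.eCoord α x * C.fCoord α x := by
  classical
  let p : 𝔤 →ₗ[ℂ] 𝔤 := (leviSubalgebra b i).toSubmodule.subtype ∘ₗ C.leviProj i
  let Φ : 𝔤 →ₗ[ℂ] 𝔤 →ₗ[ℂ] ℂ := killingForm ℂ 𝔤 - (killingForm ℂ 𝔤).compl₁₂ p p
  -- This is κ(e_α, f_α). The half cancels on the diagonal, where the two symmetrised terms of `Ψ`
  -- coincide.
  let c (α : PosRoot b) : ℂ := 2⁻¹ *
    killingForm ℂ 𝔤 ((rootSystem H).coroot α.1 : H) ((rootSystem H).coroot α.1 : H)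
  let Ψ : 𝔤 →ₗ[ℂ] 𝔤 →ₗ[ℂ] ℂ := ∑ α ∈ nilradicalRoots b i,
    c α • ((C.eCoord α).smulRight (C.fCoord α) + (C.fCoord α).smulRight (C.eCoord α))
  have hΨ (x y : 𝔤) : Ψ x y = ∑ α ∈ nilradicalRoots b i,
      c α * (C.eCoord α x * C.fCoord α y + C.fCoord α x * C.eCoord α y) := by
    simp [Ψ, LinearMap.sum_apply, mul_add]
  have hef (α : PosRoot b) :
      killingForm ℂ 𝔤 (C.basis (.inr (.inl α))) (C.basis (.inr (.inr α))) = c α := by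
    rw [eq_inv_mul_iff_mul_eq₀ two_ne_zero]
    exact two_mul_killingForm_of_lie_eq_coroot α.1 (C.basis_f α) (C.lie_e_f α)
  have hwt : ∀ α β : PosRoot b, (rootSystem H).root α.1 - (rootSystem H).root β.1 = 0 → α = β :=
    fun α β h => Subtype.ext ((rootSystem H).root.injective (sub_eq_zero.mp h))
  have hpos : ∀ α β : PosRoot b, (rootSystem H).root α.1 + (rootSystem H).root β.1 ≠ 0 := by
    intro α β h
    let := (rootSystem H).indexNeg
    have h1 : (rootSystem H).root β.1 = (rootSystem H).root (-α.1) := by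
      rw [RootPairing.indexNeg_neg, RootPairing.root_reflectionPerm,
        RootPairing.reflection_apply_self]
      exact (neg_eq_of_add_eq_zero_right h).symm
    have h2 := (rootSystem H).root.injective h1
    exact (RootPairing.Base.IsPos.neg_iff_not b α.1).mp (h2 ▸ β.2) α.2
  have key : Φ = Ψ := by
    refine C.basis.ext fun k => C.basis.ext fun l => ?_
    rw [hΨ]
    refine (C.killingForm_sub_leviProj_basis i k l).trans ?_
    simp only [eCoord_basis, fCoord_basis]
    rcases k with j | α | α
    · have : weight b (.inl j) ∈ leviSpan b i := zero_mem _
      simp [this]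
    · have hmem : weight b (.inr (.inl α)) ∈ leviSpan b i ↔ α.1 ∈ leviRoots b i := Iff.rfl
      rcases l with j | β | β
      · rw [C.killingForm_basis_eq_zero (by
          simpa [weight, -rootSystem_root_apply] using (rootSystem H).ne_zero α.1)]
        simp
      · rw [C.killingForm_basis_eq_zero (by
          simpa [weight, -rootSystem_root_apply] using hpos α β)]
        simp
      · by_cases hαβ : α = β
        · subst hαβ
          by_cases hα : α.1 ∈ leviRoots b i <;> simp [hmem, hα, hef, nilradicalRoots]
        · rw [C.killingForm_basis_eq_zero fun h => hαβ (hwt α β (by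
            simpa [weight, sub_eq_add_neg, -rootSystem_root_apply] using h))]
          simp [hαβ]
    · have hmem : weight b (.inr (.inr α)) ∈ leviSpan b i ↔ α.1 ∈ leviRoots b i := neg_mem_iff
      rcases l with j | β | β
      · rw [C.killingForm_basis_eq_zero (by
          simpa [weight, -rootSystem_root_apply] using (rootSystem H).ne_zero α.1)]
        simp
      · by_cases hαβ : α = β
        · subst hαβ
          rw [killingForm_symm]
          by_cases hα : α.1 ∈ leviRoots b i <;> simp [hmem, hα, hef, nilradicalRoots]
        · rw [C.killingForm_basis_eq_zero fun h => hαβ (hwt β α (by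
            simpa [weight, sub_eq_add_neg, add_comm, -rootSystem_root_apply] using h)).symm]
          simp [hαβ]
      · rw [C.killingForm_basis_eq_zero fun h => hpos α β (by
          simpa [weight, -rootSystem_root_apply, ← neg_add, -neg_add_rev] using h)]
        simp
  have h := LinearMap.congr_fun (LinearMap.congr_fun key x) x
  rw [hΨ] at h
  refine Eq.trans h (Finset.sum_congr rfl fun α _ => ?_)
  simp only [c]
  ring

/-- 𝔤_μ pairs nontrivially only with 𝔤_{−μ}, so 𝔩_i is orthogonal to the root spaces that the
projection kills. -/
lemma killingForm_leviProj {y : 𝔤} (hy : y ∈ leviSubalgebra b i) (x : 𝔤) :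
    killingForm ℂ 𝔤 y (C.leviProj i x) = killingForm ℂ 𝔤 y x := by
  classical
  change y ∈ ⨆ μ : leviSpan b i, (rootSpace H (μ.1 : H → ℂ)).toSubmodule at hy
  induction hy using Submodule.iSup_induction' with
  | zero => simp
  | add y₁ y₂ _ _ h₁ h₂ => simp only [map_add, LinearMap.add_apply, h₁, h₂]
  | mem μ y hy =>
    have key : killingForm ℂ 𝔤 y ∘ₗ (leviSubalgebra b i).toSubmodule.subtype ∘ₗ C.leviProj i =
        killingForm ℂ 𝔤 y := by
      refine C.basis.ext fun k => ?_
      change killingForm ℂ 𝔤 y (C.leviProj i (C.basis k)) = _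
      rw [leviProj_basis]
      split_ifs with hk
      · rfl
      · rw [map_zero, killingForm_apply_eq_zero_of_mem_rootSpace_of_add_ne_zero ℂ 𝔤 H hy
          (C.basis_mem_rootSpace k)]
        intro h
        have h' : μ.1 + weight b k = 0 := DFunLike.coe_injective h
        exact hk ((add_mem_cancel_left μ.2).mp (h' ▸ zero_mem _))
    exact LinearMap.congr_fun key x

end ChevalleyTypeBasis

/-- κ(u, u) = ∑ α(u)² is a sum of rational squares, so it vanishes only if every root vanishes at u.
-/
lemma eq_zero_of_killingForm_root_sq (u : H) (q : H.root → ℚ)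
    (hq : ∀ α : H.root, (rootSystem H).root α u = q α) (h0 : killingForm ℂ 𝔤 u u = 0) : u = 0 := by
  have hsum (w : H) : killingForm ℂ 𝔤 u w =
      ∑ α : H.root, (rootSystem H).root α u * (rootSystem H).root α w := by
    have h := LinearMap.congr_fun (LinearMap.congr_fun
      (restrict_killingForm_eq_sum (K := ℂ) (L := 𝔤) (H := H)) u) w
    rw [← Finset.sum_coe_sort] at h
    simp only [LinearMap.sum_apply, LinearMap.smulRight_apply, LinearMap.smul_apply,
      smul_eq_mul] at h
    exact h
  have hz : ∀ α, q α = 0 := by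
    rw [hsum] at h0
    simp only [hq] at h0
    have h1 : ∑ α, q α * q α = 0 := by exact_mod_cast h0
    rw [Finset.sum_eq_zero_iff_of_nonneg fun α _ => mul_self_nonneg _] at h1
    exact fun α => mul_self_eq_zero.mp (h1 α (Finset.mem_univ α))
  refine (traceForm_cartan_nondegenerate ℂ 𝔤 H).1 u fun w => ?_
  refine (hsum w).trans (Finset.sum_eq_zero fun α _ => ?_)
  rw [hq, hz]
  simp

/-- The hypothesis makes α_i orthogonal to every other simple root. The line through α_i is then
stable under all simple reflections, hence everything by irreducibility. -/
lemma finrank_le_one_of_coroot_eq (i : b.support)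
    (h : (2 : ℂ) • fundamentalCoweight b i = (rootSystem H).coroot i) : finrank ℂ H ≤ 1 := by
  classical
  have hpair : ∀ j : b.support, j ≠ i → (rootSystem H).pairing i j = 0 := by
    intro j hj
    rw [RootPairing.pairing_eq_zero_iff]
    have h1 : (rootSystem H).root j ((rootSystem H).coroot i) = 0 := by
      rw [← h, map_smul, root_fundamentalCoweight, if_neg hj, smul_zero]
    exact h1
  have htop : Submodule.span ℂ {(rootSystem H).root i} = ⊤ := by
    refine RootPairing.IsIrreducible.eq_top_of_invtSubmodule_reflection (P := rootSystem H) _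
      ((b.forall_mem_support_invtSubmodule_iff _).mp fun j hj => ?_) ?_
    · rw [Module.End.mem_invtSubmodule, Submodule.span_le, Set.singleton_subset_iff]
      change (rootSystem H).reflection j ((rootSystem H).root i) ∈ Submodule.span ℂ _
      by_cases hji : (⟨j, hj⟩ : b.support) = i
      · have : j = i := congrArg Subtype.val hji
        rw [this, RootPairing.reflection_apply_self]
        exact neg_mem (Submodule.mem_span_singleton_self _)
      · rw [RootPairing.reflection_apply_root, hpair _ hji, zero_smul, sub_zero]
        exact Submodule.mem_span_singleton_self _
    · rw [Ne, Submodule.span_singleton_eq_bot]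
      exact (rootSystem H).ne_zero i
  rw [← Subspace.dual_finrank_eq, ← finrank_top, ← htop]
  exact (finrank_span_singleton ((rootSystem H).ne_zero i)).le

/-- In rank at least two, `⟨ϖ_i, ϖ_i^∨⟩ ≠ 1/2`. -/
lemma two_mul_fundamentalWeight_fundamentalCoweight_ne_one (i : b.support)
    (hrank : 1 < finrank ℂ H) :
    2 * fundamentalWeight b i (fundamentalCoweight b i) ≠ 1 := by
  classical
  intro h
  refine absurd (finrank_le_one_of_coroot_eq i ?_) (not_le.mpr hrank)
  choose n hn _ using exists_int_root_fundamentalCoweight b i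
  -- The Cartan integer α(α_i^∨), read off from the α_i-string through α.
  let m (α : H.root) : ℤ := LieModule.chainBotCoeff i.1.1 α.1 - LieModule.chainTopCoeff i.1.1 α.1
  have hm (α : H.root) : (rootSystem H).root α ((rootSystem H).coroot i) = (m α : ℂ) :=
    apply_coroot_eq_cast i.1.1 α.1
  -- For u = 2ϖ_i^∨ − α_i^∨ one has κ(u, u) = κ_{α_i}(2ϖ_i(ϖ_i^∨) − 1), which is zero by assumption,
  -- and roots take integer values at u.
  refine sub_eq_zero.mp (eq_zero_of_killingForm_root_sq _ (fun α => 2 * n α - m α) (fun α => ?_) ?_)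
  · rw [map_sub, map_smul, hn, hm]
    simp
  · have h1 := two_mul_killingForm_fundamentalCoweight b i (fundamentalCoweight b i)
    have h2 := two_mul_killingForm_fundamentalCoweight b i ((rootSystem H).coroot i)
    rw [fundamentalWeight_coroot, if_pos rfl] at h2
    have h3 := killingForm_symm (𝔤 := 𝔤) ((rootSystem H).coroot i : H) (fundamentalCoweight b i : H)
    simp only [AddSubgroupClass.coe_sub, SetLike.val_smul, map_sub, map_smul, LinearMap.sub_apply,
      LinearMap.smul_apply, smul_eq_mul, h3]
    linear_combination 2 * h1 - 2 * h2 +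
      killingForm ℂ 𝔤 ((rootSystem H).coroot i : H) ((rootSystem H).coroot i : H) * h

end Levi

/-! ### The cominuscule case -/

section Cominuscule

variable {𝔤 : Type*} [LieRing 𝔤] [LieAlgebra ℂ 𝔤] [FiniteDimensional ℂ 𝔤]
  [LieAlgebra.IsSimple ℂ 𝔤] {H : LieSubalgebra ℂ 𝔤} [H.IsCartanSubalgebra]
  {b : (rootSystem H).Base}

lemma normalizedForm_apply (i : b.support) (x y : 𝔤) :
    normalizedForm b i x y =
      (killingForm ℂ 𝔤 ((rootSystem H).coroot i : H) ((rootSystem H).coroot i : H))⁻¹ *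
        killingForm ℂ 𝔤 x y := rfl

namespace ChevalleyTypeBasis

variable (C : ChevalleyTypeBasis b) (i : b.support)

lemma weightForm_eq_normalizedForm (x : 𝔤) :
    C.weightForm (fundamentalWeight b i) x =
      2 * normalizedForm b i (fundamentalCoweight b i : H) x := by
  have h := C.weightForm_fundamentalWeight i x
  have h0 := killingForm_coroot_self_ne_zero (i : H.root)
  rw [normalizedForm_apply, ← mul_right_inj' h0, h]
  field_simp

lemma weightForm_coe (i : b.support) (h : H) :
    C.weightForm (fundamentalWeight b i) (h : 𝔤) = fundamentalWeight b i h := by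
  rw [← mul_right_inj' (killingForm_coroot_self_ne_zero (i : H.root)),
    C.weightForm_fundamentalWeight, two_mul_killingForm_fundamentalCoweight]

lemma weightForm_leviProj (x : 𝔤) :
    C.weightForm (fundamentalWeight b i) (C.leviProj i x) =
      C.weightForm (fundamentalWeight b i) x := by
  rw [weightForm_eq_normalizedForm, weightForm_eq_normalizedForm, normalizedForm_apply,
    normalizedForm_apply, C.killingForm_leviProj i (cartan_le_leviSubalgebra b i _)]

/-- By invariance, B(ϖ_i^∨, [y, z]) = B([ϖ_i^∨, y], z), and ϖ_i^∨ centralises 𝔩_i. Here z may be any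
element of 𝔤. -/
lemma weightForm_lie_of_mem_leviSubalgebra {y : 𝔤} (hy : y ∈ leviSubalgebra b i) (z : 𝔤) :
    C.weightForm (fundamentalWeight b i) ⁅y, z⁆ = 0 := by
  rw [weightForm_eq_normalizedForm, normalizedForm_apply, ← killingForm_lie_apply,
    lie_fundamentalCoweight_of_mem_leviSubalgebra i hy]
  simp

/-- Being cominuscule turns the coefficient ϖ_i(α^∨) into the ratio κ_α/κ_{α_i}, exactly the
coefficient in B minus its pullback from 𝔩_i. -/
lemma sum_nilradicalRoots_eq_of_isCominuscule (hi : IsCominuscule b i) (x : 𝔤) :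
    ∑ α ∈ nilradicalRoots b i,
        fundamentalWeight b i ((rootSystem H).coroot α.1) * C.eCoord α x * C.fCoord α x =
      dualCasimir (normalizedForm b i) x -
        dualCasimir ((normalizedForm b i).restrict (leviSubalgebra b i).toSubmodule)
          (C.leviProj i x) := by
  have h0 := killingForm_coroot_self_ne_zero (i : H.root)
  have h1 := C.killingForm_self_sub_leviProj i x
  have h2 : dualCasimir (normalizedForm b i) x -
      dualCasimir ((normalizedForm b i).restrict (leviSubalgebra b i).toSubmodule)
        (C.leviProj i x) =
      (killingForm ℂ 𝔤 ((rootSystem H).coroot i : H) ((rootSystem H).coroot i : H))⁻¹ *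
        (killingForm ℂ 𝔤 x x - killingForm ℂ 𝔤 (C.leviProj i x) (C.leviProj i x)) := by
    rw [mul_sub]
    rfl
  rw [h2, h1, Finset.mul_sum]
  refine Finset.sum_congr rfl fun α hα => ?_
  have h3 := killingForm_mul_fundamentalWeight_coroot b i α.1
  rw [hi.root_fundamentalCoweight_eq_one b i (by simpa [nilradicalRoots] using hα), mul_one] at h3
  rw [← h3]
  field_simp

/-- The form `B - ϖ_i ⊗ ϖ_i` on the Levi subalgebra `𝔩_i`. -/
def leviForm : LinearMap.BilinForm ℂ (leviSubalgebra b i) :=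
  (normalizedForm b i).restrict (leviSubalgebra b i).toSubmodule -
    ((C.weightForm (fundamentalWeight b i)) ∘ₗ (leviSubalgebra b i).toSubmodule.subtype).smulRight
      ((C.weightForm (fundamentalWeight b i)) ∘ₗ (leviSubalgebra b i).toSubmodule.subtype)

lemma leviForm_apply (y z : leviSubalgebra b i) :
    C.leviForm i y z = normalizedForm b i (y : 𝔤) (z : 𝔤) -
      C.weightForm (fundamentalWeight b i) y * C.weightForm (fundamentalWeight b i) z := rfl

lemma leviForm_isSymm : (C.leviForm i).IsSymm := by
  refine ⟨fun y z => ?_⟩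
  rw [leviForm_apply, leviForm_apply, normalizedForm_apply, normalizedForm_apply,
    killingForm_symm (y : 𝔤), mul_comm (C.weightForm _ _)]

lemma leviForm_apply_lie (x y z : leviSubalgebra b i) :
    C.leviForm i x ⁅y, z⁆ = normalizedForm b i x ⁅(y : 𝔤), (z : 𝔤)⁆ := by
  rw [leviForm_apply, LieSubalgebra.coe_bracket, C.weightForm_lie_of_mem_leviSubalgebra i y.2,
    mul_zero, sub_zero]

lemma leviForm_lie_apply (x y z : leviSubalgebra b i) :
    C.leviForm i ⁅x, y⁆ z = C.leviForm i x ⁅y, z⁆ := by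
  rw [leviForm_apply_lie, leviForm_apply, LieSubalgebra.coe_bracket,
    C.weightForm_lie_of_mem_leviSubalgebra i x.2, zero_mul, sub_zero, normalizedForm_apply,
    normalizedForm_apply, killingForm_lie_apply]

lemma leviForm_nondegenerate (hrank : 1 < finrank ℂ H) : (C.leviForm i).Nondegenerate := by
  refine (C.leviForm_isSymm i).isRefl.nondegenerate_iff_separatingLeft.mpr ?_
  intro y hy
  have h0 := inv_ne_zero (killingForm_coroot_self_ne_zero (i : H.root))
  set c := C.weightForm (fundamentalWeight b i) y
  -- Since B(y, pr_i x) = B(y, x) and ϖ_i ∘ pr_i = ϖ_i, testing y against all pr_i x gives B(y, x) =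
  -- 2c B(ϖ_i^∨, x) on the whole of 𝔤.
  have hyc : (y : 𝔤) = (2 * c) • (fundamentalCoweight b i : 𝔤) := by
    refine sub_eq_zero.mp ((killingForm_nondegenerate ℂ 𝔤).1 _ fun x => ?_)
    have h1 := hy (C.leviProj i x)
    rw [leviForm_apply, C.weightForm_leviProj, C.weightForm_eq_normalizedForm i x,
      normalizedForm_apply, normalizedForm_apply, C.killingForm_leviProj i y.2] at h1
    rw [map_sub, map_smul, LinearMap.sub_apply, LinearMap.smul_apply, smul_eq_mul,
      ← mul_right_inj' h0]
    linear_combination h1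
  -- Applying ϖ_i to y = 2c ϖ_i^∨ gives c = 2c ϖ_i(ϖ_i^∨).
  have hc : c = 0 := by
    have h1 : c = 2 * c * fundamentalWeight b i (fundamentalCoweight b i) := by
      conv_lhs => rw [show c = C.weightForm (fundamentalWeight b i) y from rfl, hyc, map_smul,
        C.weightForm_coe, smul_eq_mul]
    by_contra hc
    refine two_mul_fundamentalWeight_fundamentalCoweight_ne_one i hrank (mul_left_cancel₀ hc ?_)
    linear_combination -h1
  rw [hc, mul_zero, zero_smul] at hyc
  exact Subtype.ext hyc

end ChevalleyTypeBasis

end Cominuscule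

end

theorem proposition3p1
    {𝔤 : Type*} [LieRing 𝔤] [LieAlgebra ℂ 𝔤] [FiniteDimensional ℂ 𝔤] [LieAlgebra.IsSimple ℂ 𝔤]
    (H : LieSubalgebra ℂ 𝔤) [H.IsCartanSubalgebra]
    (b : (LieAlgebra.IsKilling.rootSystem H).Base) (C : ChevalleyTypeBasis b) (i : b.support)
    {V : Type*} [AddCommGroup V] [Module ℂ V] [LieRingModule 𝔤 V] [LieModule ℂ 𝔤 V]
    [FiniteDimensional ℂ V] [LieModule.IsIrreducible ℂ 𝔤 V]
    (v : V) (hv : IsHighestWeightVector b (fundamentalWeight b i) v)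
    (ξ : Module.Dual ℂ V) (hξ : IsLowestWeightVector b (-fundamentalWeight b i) ξ)
    (hξv : ξ v = 1) :
    -- the linear Hamiltonian
    (∀ x : 𝔤, (hamiltonian ξ v 1 : polyFun 𝔤).1 x = C.weightForm (fundamentalWeight b i) x) ∧
    -- the quadratic Hamiltonian
    (∀ x : 𝔤, (hamiltonian ξ v 2 : polyFun 𝔤).1 x =
      C.weightForm (fundamentalWeight b i) x ^ 2 +
        ∑ α ∈ nilradicalRoots b i,
          fundamentalWeight b i ((LieAlgebra.IsKilling.rootSystem H).coroot α.1) *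
            C.eCoord α x * C.fCoord α x) ∧
    -- Hamiltonians of any order
    (∀ n : ℕ,
      (hamiltonian ξ v n : polyFun 𝔤) ∈ polyInvariants (adjointGroup (leviRoots b i)) ∧
      Ideal.Quotient.mk (positiveInvariantIdeal (adjointGroup (H := H) Set.univ))
          (hamiltonian ξ v n) ∈
        (polyInvariants (adjointGroup (leviRoots b i))).map
          (Ideal.Quotient.mkₐ ℂ (positiveInvariantIdeal (adjointGroup (H := H) Set.univ)))) ∧
    -- the cominuscule case
    (IsCominuscule b i →
      (∀ x : 𝔤, (hamiltonian ξ v 2 : polyFun 𝔤).1 x =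
        C.weightForm (fundamentalWeight b i) x ^ 2 +
          (dualCasimir (normalizedForm b i) x -
            dualCasimir ((normalizedForm b i).restrict (leviSubalgebra b i).toSubmodule)
              (C.leviProj i x))) ∧
      ∃ β : LinearMap.BilinForm ℂ (leviSubalgebra b i),
        β.IsSymm ∧
        (∀ x y z : leviSubalgebra b i, β ⁅x, y⁆ z = β x ⁅y, z⁆) ∧
        (∀ x y z : leviSubalgebra b i, β x ⁅y, z⁆ = normalizedForm b i x ⁅(y : 𝔤), (z : 𝔤)⁆) ∧
        (1 < Module.finrank ℂ H → β.Nondegenerate) ∧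
        ∀ x : 𝔤, (hamiltonian ξ v 2 : polyFun 𝔤).1 x =
          dualCasimir (normalizedForm b i) x - dualCasimir β (C.leviProj i x)) := by
  
  have h1 : ∀ x : 𝔤, (hamiltonian ξ v 1 : polyFun 𝔤).1 x =
      C.weightForm (fundamentalWeight b i) x := fun x => by
    change hamiltonianFun ξ v 1 x = _
    rw [hamiltonianFun_eq, pow_one]
    exact C.apply_lie_eq_weightForm hv hξ hξv x
  have h2 : ∀ x : 𝔤, (hamiltonian ξ v 2 : polyFun 𝔤).1 x =
      C.weightForm (fundamentalWeight b i) x ^ 2 +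
        ∑ α ∈ nilradicalRoots b i,
          fundamentalWeight b i ((LieAlgebra.IsKilling.rootSystem H).coroot α.1) *
            C.eCoord α x * C.fCoord α x := fun x => by
    change hamiltonianFun ξ v 2 x = _
    rw [hamiltonianFun_eq, sq, sq]
    exact C.apply_lie_lie_eq i hv hξ hξv x x
  refine ⟨h1, h2, fun n => ?_, fun hi => ⟨fun x => ?_, C.leviForm i, C.leviForm_isSymm i,
    C.leviForm_lie_apply i, C.leviForm_apply_lie i, C.leviForm_nondegenerate i, fun x => ?_⟩⟩
  · have h := hamiltonian_mem_polyInvariants C hv hξ n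
    exact ⟨h, Subalgebra.mem_map.mpr ⟨_, h, rfl⟩⟩
  · rw [h2, C.sum_nilradicalRoots_eq_of_isCominuscule i hi]
  · rw [h2, C.sum_nilradicalRoots_eq_of_isCominuscule i hi]
    -- Subtracting the Casimir of B − ϖ_i ⊗ ϖ_i restores the summand ϖ_i², because ϖ_i does not
    -- change under pr_i.
    simp only [dualCasimir, C.leviForm_apply, C.weightForm_leviProj,
      LinearMap.BilinForm.restrict_apply, LinearMap.domRestrict_apply]
    ring
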